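/- Consider the downlink of a cellular network with $G$ cells, one base station (BS) with $N$ antennas per cell, $K_g \ge 0$ users in cell $g$ (at least one user in total), each user having $M$ antennas and being served one data stream. Let $H_{(i,gk)} \in \mathbb{C}^{M\times N}$ be the channel matrix from BS $i$ to the $k$-th user of cell $g$, and let $\mathcal I \subseteq \{(i,gk) : 1\le i,g\le G,\ g\ne i,\ 1\le k\le K_g\}$ be a set of BS–user pairs. Beamformers that null the interference prescribed by $\mathcal I$ are nonzero receive vectors $u_{gk}\in\mathbb{C}^M$ and transmit vectors $v_{gk}\in\mathbb{C}^N$, one of each for every user, such that $v_{g1},\dots,v_{gK_g}$ are linearly independent for every $g$ and $$u_{gk}^H H_{(i,gk)} v_{ij} = 0 \qquad \text{for all } (i,gk)\in\mathcal I \text{ and all } j\in\{1,\dots,K_i\}.$$ For $\mathcal J\subseteq \mathcal I$ let $\mathcal J_{users}$ and $\mathcal J_{BS}$ be the sets of user indices $gk$ and of BS indices $i$ that appear in $\mathcal J$. Then, for generic channels (that is, for all channel coefficients in some non-empty Zariski open subset of the space of all channel coefficients over $\mathbb{C}$), such beamformers exist if and only if $M\ge 1$, $N\ge K_g$ for every $g$,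 and $$|\mathcal J_{users}|\,(M-1)+\sum_{l\in\mathcal J_{BS}}(N-K_l)K_l\ \ge\ \sum_{(l,gk)\in\mathcal J}K_l \qquad\text{for every } \mathcal J\subseteq\mathcal I.$$ In particular, if every cell has the same number $K$ of users, then for generic channels such beamformers exist if and only if $M\ge1$, $N\ge K$, and $$|\mathcal J_{users}|\,(M-1)+|\mathcal J_{BS}|\,(N-K)K\ \ge\ |\mathcal J|\,K \qquad\text{for every } \mathcal J\subseteq\mathcal I.$$ -/

import Mathlib

namespace CellularIA

/-- A subset of affine space `ℂ^σ` is Zariski open if it is the complement of the common zero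
locus of a set `S` of polynomials. -/
def IsZariskiOpen {σ : Type} (U : Set (σ → ℂ)) : Prop :=
  ∃ S : Set (MvPolynomial σ ℂ), U = {x | ∀ p ∈ S, MvPolynomial.eval x p = 0}ᶜ

/-- A property of points of `ℂ^σ` holds generically if it holds on a non-empty Zariski open set. -/
def Generically {σ : Type} (P : (σ → ℂ) → Prop) : Prop :=
  ∃ U : Set (σ → ℂ), IsZariskiOpen U ∧ U.Nonempty ∧ ∀ x ∈ U, P x

/-- The users of a network with `G` cells and `K g` users in cell `g`: the double indices `gk`. -/
abbrev User {G : ℕ} (K : Fin G → ℕ) : Type := Σ g : Fin G, Fin (K g)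

/-- BS-user pairs `(i, gk)`. -/
abbrev BSUser {G : ℕ} (K : Fin G → ℕ) : Type := Fin G × User K

/-- Index set of all channel coefficients: one `M × N` matrix for every BS-user pair. -/
abbrev Coeff {G : ℕ} (K : Fin G → ℕ) (M N : ℕ) : Type := BSUser K × Fin M × Fin N

/-- The `M × N` channel matrix `H_(i,gk)` from BS `i` to user `gk`, read off from the vector of
all channel coefficients. -/
def channel {G : ℕ} {K : Fin G → ℕ} {M N : ℕ} (h : Coeff K M N → ℂ) (p : BSUser K) :
    Matrix (Fin M) (Fin N) ℂ :=
  Matrix.of fun a b => h (p, a, b)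

/-- For the channel coefficients `h` there are receive beamformers `u_gk ∈ ℂ^M` (nonzero) and
transmit beamformers `v_gk ∈ ℂ^N` (linearly independent within each cell) such that, for every
pair `(i, gk) ∈ I`, the interference of BS `i` at user `gk` is completely nulled:
`u_gkᴴ H_(i,gk) v_ij = 0` for all users `j` of cell `i`. -/
def Feasible {G : ℕ} {K : Fin G → ℕ} {M N : ℕ} (I : Finset (BSUser K))
    (h : Coeff K M N → ℂ) : Prop :=
  ∃ (u : User K → Fin M → ℂ) (v : User K → Fin N → ℂ),
    (∀ gk, u gk ≠ 0) ∧
    (∀ g : Fin G, LinearIndependent ℂ (fun k : Fin (K g) => v ⟨g, k⟩)) ∧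
    ∀ p ∈ I, ∀ j : Fin (K p.1),
      dotProduct (star (u p.2)) ((channel h p).mulVec (v ⟨p.1, j⟩)) = 0

/-- The BS indices that appear in `J`. -/
def bsOf {G : ℕ} {K : Fin G → ℕ} (J : Finset (BSUser K)) : Finset (Fin G) := J.image Prod.fst

/-- The user indices that appear in `J`. -/
def usersOf {G : ℕ} {K : Fin G → ℕ} (J : Finset (BSUser K)) : Finset (User K) :=
  J.image Prod.snd

end CellularIA

/- Gauge the beamformers so that every receive vector has one entry equal to `1` and the transmit
vectors of every cell contain an identity matrix in `K g` of their `N` coordinates. There are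
finitely many such charts, and in a chart each nulling equation is linear with coefficient `1` in
one channel coefficient of its own, so the equations parametrise the channels by their other
coefficients and the remaining free beamformer coordinates. If some set of equations involves fewer
free coordinates than equations, each chart covers only channels satisfying a nontrivial algebraic
relation. Otherwise Hall's theorem matches each equation to a free coordinate of its own, the
matching yields a point where the Jacobian has full rank, and by Chevalley's theorem the image
contains a non-empty open set. -/

namespace CellularIA

open MvPolynomial

section Algebra

theorem exists_submatrix_det_ne_zero {F m n : Type*} [Field F] [Fintype m] [DecidableEq m]
    [Finite n] (A : Matrix m n F) (hA : LinearIndependent F A.row) :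
    ∃ s : m ↪ n, (A.submatrix id s).det ≠ 0 := by
  classical
  have : Fintype n := Fintype.ofFinite n
  obtain ⟨κ, a, ha, hspan, hli⟩ := exists_linearIndependent' F A.col
  have : Fintype κ := Fintype.ofInjective a ha
  have hcard : Fintype.card κ = Fintype.card m := by
    rw [← finrank_span_eq_card hli, hspan, ← Matrix.rank_eq_finrank_span_cols,
      hA.rank_matrix]
  let e : m ≃ κ := (Fintype.equivOfCardEq hcard).symm
  refine ⟨e.toEmbedding.trans ⟨a, ha⟩, ?_⟩
  have h : LinearIndependent F (A.submatrix id (a ∘ e)).col := hli.comp e e.injective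
  rw [Matrix.linearIndependent_cols_iff_isUnit, Matrix.isUnit_iff_isUnit_det] at h
  exact h.ne_zero

theorem exists_mul_submatrix_eq_one {F m n : Type*} [Field F] [Fintype m] [DecidableEq m]
    [Finite n] (A : Matrix m n F) (hA : LinearIndependent F A.row) :
    ∃ (s : m ↪ n) (B : Matrix m m F), (B * A).submatrix id s = 1 := by
  obtain ⟨s, hs⟩ := exists_submatrix_det_ne_zero A hA
  refine ⟨s, (A.submatrix id s)⁻¹, ?_⟩
  rw [Matrix.submatrix_mul_equiv _ _ _ (Equiv.refl m) _ |>.symm]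
  exact Matrix.nonsing_inv_mul _ hs.isUnit

theorem totalDegree_pderiv_le {R ι : Type*} [CommSemiring R] (p : MvPolynomial ι R) (i : ι) :
    (pderiv i p).totalDegree ≤ p.totalDegree - 1 := by
  refine Finset.sup_le fun m hm => ?_
  rw [mem_support_iff, coeff_pderiv] at hm
  have h := le_totalDegree (mem_support_iff.2 (left_ne_zero_of_mul hm))
  rw [Finsupp.sum_add_index' (fun _ => rfl) (fun _ _ _ => rfl), Finsupp.sum_single_index rfl] at h
  exact Nat.le_sub_of_add_le h

theorem eq_C_of_pderiv_eq_zero {R ι : Type*} [CommSemiring R] [NoZeroDivisors R] [CharZero R]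
    {p : MvPolynomial ι R} (hp : ∀ i, pderiv i p = 0) : p = C (coeff 0 p) := by
  classical
  ext m
  rw [coeff_C]
  split_ifs with h
  · rw [h]
  · obtain ⟨i, hi⟩ : ∃ i, m i ≠ 0 := by
      by_contra! H
      exact h (Finsupp.ext fun i => (H i).symm)
    have h1 := congrArg (coeff (m - Finsupp.single i 1)) (hp i)
    rw [coeff_pderiv, tsub_add_cancel_of_le (by simpa [Nat.one_le_iff_ne_zero] using hi),
      coeff_zero] at h1
    exact (mul_eq_zero.1 h1).resolve_right (Nat.cast_add_one_ne_zero _)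

theorem pderiv_aeval {R ι τ : Type*} [CommSemiring R] [Fintype ι]
    (φ : ι → MvPolynomial τ R) (t : τ) (p : MvPolynomial ι R) :
    pderiv t (aeval φ p) = ∑ i, aeval φ (pderiv i p) * pderiv t (φ i) := by
  classical
  induction p using MvPolynomial.induction_on with
  | C a => simp [algebraMap_eq]
  | add p q hp hq => simp only [map_add, hp, hq, add_mul, Finset.sum_add_distrib]
  | mul_X p k h =>
    simp only [map_mul, aeval_X, Derivation.leibniz, smul_eq_mul, h, map_add, pderiv_X, add_mul,
      Finset.sum_add_distrib, Finset.mul_sum]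
    congr 1
    · rw [Finset.sum_eq_single k]
      · simp
      · intro b _ hb
        simp [hb.symm]
      · simp
    · exact Finset.sum_congr rfl fun i _ => by ring

theorem algebraicIndependent_of_det_pderiv_ne_zero {F ι τ : Type*} [Field F] [CharZero F]
    [Fintype ι] [DecidableEq ι] (φ : ι → MvPolynomial τ F) (s : ι → τ)
    (h : (Matrix.of fun i k => pderiv (s k) (φ i)).det ≠ 0) : AlgebraicIndependent F φ := by
  rw [algebraicIndependent_iff]
  suffices ∀ (n : ℕ) (p : MvPolynomial ι F), p.totalDegree ≤ n → aeval φ p = 0 → p = 0 from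
    fun p hp => this _ p le_rfl hp
  have eq_zero_of_eq_C : ∀ p : MvPolynomial ι F, p = C (coeff 0 p) → aeval φ p = 0 → p = 0 := by
    intro p hp h0
    rw [hp, aeval_C, algebraMap_eq, C_eq_zero] at h0
    rw [hp, h0, C_0]
  intro n
  induction n with
  | zero => exact fun p hp => eq_zero_of_eq_C p (totalDegree_eq_zero_iff_eq_C.1 (Nat.le_zero.1 hp))
  | succ n ih =>
    intro p hp h0
    refine eq_zero_of_eq_C p (eq_C_of_pderiv_eq_zero fun i => ih _ ?_ ?_) h0
    · exact (totalDegree_pderiv_le p i).trans (Nat.sub_le_of_le_add hp)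
    · have hv : Matrix.vecMul (fun i => aeval φ (pderiv i p))
          (Matrix.of fun i k => pderiv (s k) (φ i)) = 0 := by
        funext k
        have := pderiv_aeval φ (s k) p
        rw [h0, map_zero] at this
        exact this.symm
      exact congrFun (Matrix.eq_zero_of_vecMul_eq_zero h hv) i

theorem algebraicIndependent_of_linearIndependent_pderiv {F ι τ : Type*} [Field F] [CharZero F]
    [Finite ι] [Finite τ] (φ : ι → MvPolynomial τ F) (x : τ → F)
    (h : LinearIndependent F fun i t => eval x (pderiv t (φ i))) :
    AlgebraicIndependent F φ := by
  classical
  have := Fintype.ofFinite ι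
  have := Fintype.ofFinite τ
  obtain ⟨s, hs⟩ := exists_submatrix_det_ne_zero
    (Matrix.of fun i t => eval x (pderiv t (φ i))) h
  refine algebraicIndependent_of_det_pderiv_ne_zero φ s fun h0 => hs ?_
  have := congrArg (eval x) h0
  rwa [RingHom.map_det, map_zero] at this

theorem exists_aeval_eq_zero_of_card_lt {R ι τ : Type*} [CommRing R] [IsDomain R] [Fintype ι]
    [Fintype τ] (φ : ι → MvPolynomial τ R) (h : Fintype.card τ < Fintype.card ι) :
    ∃ p : MvPolynomial ι R, p ≠ 0 ∧ aeval φ p = 0 := by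
  by_contra! H
  have hφ : AlgebraicIndependent R φ :=
    (algebraicIndependent_iff).2 fun p hp => by_contra fun hp0 => H p hp0 hp
  have := hφ.lift_cardinalMk_le_trdeg
  rw [MvPolynomial.trdeg_of_isDomain] at this
  simp only [Cardinal.mk_fintype, Cardinal.lift_natCast, Nat.cast_le] at this
  omega

theorem exists_basicOpen_subset_range_comap {R S : Type*} [CommRing R] [CommRing S] [IsDomain S]
    (f : R →+* S) (hfp : f.FinitePresentation) (hf : Function.Injective f) :
    ∃ c : R, c ≠ 0 ∧ (PrimeSpectrum.basicOpen c : Set (PrimeSpectrum R)) ⊆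
      Set.range (PrimeSpectrum.comap f) := by
  have := hf.isDomain f
  obtain ⟨S, hS⟩ := PrimeSpectrum.exists_constructibleSetData_iff.2
    (PrimeSpectrum.isConstructible_range_comap hfp)
  have hbot : (⊥ : PrimeSpectrum R) ∈ S.toSet := by
    rw [hS]
    exact ⟨⊥, PrimeSpectrum.ext ((RingHom.injective_iff_ker_eq_bot f).1 hf)⟩
  simp only [PrimeSpectrum.ConstructibleSetData.toSet, Set.mem_iUnion] at hbot
  obtain ⟨B, hB, hzero, hne⟩ := hbot
  refine ⟨B.f, fun h0 => hne (by simp [h0]), fun P hP => ?_⟩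
  have hg : ∀ k, B.g k = 0 := fun k => by simpa using hzero (Set.mem_range_self k)
  rw [← hS]
  simp only [PrimeSpectrum.ConstructibleSetData.toSet, Set.mem_iUnion]
  refine ⟨B, hB, ?_, fun h => hP (h rfl)⟩
  rintro _ ⟨k, rfl⟩
  rw [hg]
  exact zero_mem _

theorem finitePresentation_aeval {R ι τ : Type*} [CommRing R] [IsNoetherianRing R] [Finite ι]
    [Finite τ] (φ : ι → MvPolynomial τ R) :
    (aeval φ : MvPolynomial ι R →ₐ[R] MvPolynomial τ R).toRingHom.FinitePresentation := by
  refine RingHom.FinitePresentation.of_finiteType.1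
    (RingHom.FiniteType.of_comp_finiteType (f := C) ?_)
  have : (aeval φ : MvPolynomial ι R →ₐ[R] MvPolynomial τ R).toRingHom.comp C =
      algebraMap R (MvPolynomial τ R) := (aeval φ).comp_algebraMap
  rw [this]
  exact RingHom.finiteType_algebraMap.2 inferInstance

theorem exists_forall_exists_eval_eq {F ι τ : Type*} [Field F] [IsAlgClosed F]
    [Finite ι] [Finite τ] (φ : ι → MvPolynomial τ F) (hφ : AlgebraicIndependent F φ) :
    ∃ c : MvPolynomial ι F, c ≠ 0 ∧ ∀ y : ι → F, eval y c ≠ 0 →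
      ∃ x : τ → F, ∀ i, eval x (φ i) = y i := by
  obtain ⟨c, hc, hrange⟩ := exists_basicOpen_subset_range_comap _ (finitePresentation_aeval φ) hφ
  refine ⟨c, hc, fun y hy => ?_⟩
  obtain ⟨Q, hQ⟩ := hrange (show ⟨vanishingIdeal F {y}, inferInstance⟩ ∈ _ from fun h => hy <| by
    simpa using h)
  obtain ⟨m, hm, hQm⟩ := Q.asIdeal.exists_le_maximal Q.isPrime.ne_top
  obtain ⟨x, rfl⟩ := eq_vanishingIdeal_singleton_of_isMaximal F hm
  refine ⟨x, fun i => ?_⟩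
  have hi : X i - C (y i) ∈ vanishingIdeal F {y} := by simp
  have := hQm ((PrimeSpectrum.ext_iff.1 hQ).ge hi)
  simpa [sub_eq_zero] using this

end Algebra

section Generic

variable {σ : Type}

theorem generically_iff_exists_eval_ne_zero {P : (σ → ℂ) → Prop} :
    Generically P ↔ ∃ c : MvPolynomial σ ℂ, c ≠ 0 ∧ ∀ x, eval x c ≠ 0 → P x := by
  constructor
  · rintro ⟨_, ⟨S, rfl⟩, ⟨x, hx⟩, h⟩
    obtain ⟨c, hc, hxc⟩ : ∃ c ∈ S, eval x c ≠ 0 := by simpa using hx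
    exact ⟨c, fun h0 => hxc (by simp [h0]), fun y hy => h y fun hS => hy (hS c hc)⟩
  · rintro ⟨c, hc, h⟩
    obtain ⟨x, hx⟩ : ∃ x, eval x c ≠ 0 := by
      by_contra! h0
      exact hc (MvPolynomial.funext (by simpa using h0))
    exact ⟨_, ⟨{c}, rfl⟩, ⟨x, by simpa using hx⟩, fun y hy => h y (by simpa using hy)⟩

theorem Generically.mono {P Q : (σ → ℂ) → Prop} (hP : Generically P) (h : ∀ x, P x → Q x) :
    Generically Q := by
  obtain ⟨U, hU, hne, hUP⟩ := hP
  exact ⟨U, hU, hne, fun x hx => h x (hUP x hx)⟩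

theorem Generically.of_forall {P : (σ → ℂ) → Prop} (h : ∀ x, P x) : Generically P :=
  generically_iff_exists_eval_ne_zero.2 ⟨1, one_ne_zero, fun x _ => h x⟩

theorem generically_forall {ι : Type*} [Finite ι] {P : ι → (σ → ℂ) → Prop}
    (h : ∀ i, Generically (P i)) : Generically fun x => ∀ i, P i x := by
  have := Fintype.ofFinite ι
  simp only [generically_iff_exists_eval_ne_zero] at h ⊢
  choose c hc hP using h
  refine ⟨∏ i, c i, Finset.prod_ne_zero_iff.2 fun i _ => hc i, fun x hx i => hP i x ?_⟩
  rw [map_prod, Finset.prod_ne_zero_iff] at hx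
  exact hx i (Finset.mem_univ i)

theorem exists_forall_submatrix_det_ne_zero (m n : Type) [DecidableEq m] [Finite m] [Finite n] :
    ∃ A : Matrix m n ℂ, ∀ (S : Finset m) (f : S ↪ n),
      (A.submatrix Subtype.val f).det ≠ 0 := by
  classical
  have := Fintype.ofFinite m
  have := Fintype.ofFinite n
  have generic_minor : ∀ q : (Σ S : Finset m, S ↪ n), Generically fun x : m × n → ℂ =>
      (Matrix.of fun a b => x (Subtype.val a, q.2 b)).det ≠ 0 := by
    rintro ⟨S, f⟩
    let D : Matrix S S (MvPolynomial (m × n) ℂ) := Matrix.of fun a b => X (a.1, f b)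
    have eval_D : ∀ x : m × n → ℂ,
        eval x D.det = (Matrix.of fun a b : S => x (a, f b)).det := fun x => by
      rw [RingHom.map_det]
      congr 1
      ext a b
      simp [D]
    refine generically_iff_exists_eval_ne_zero.2 ⟨D.det, fun h0 => ?_, fun x hx => eval_D x ▸ hx⟩
    have h1 := eval_D fun q => if ∃ a : S, a.1 = q.1 ∧ f a = q.2 then 1 else 0
    have : (Matrix.of fun a b : S => if ∃ a' : S, a'.1 = a.1 ∧ f a' = f b then (1 : ℂ) else 0) =
        1 := by
      ext a b
      simp [Matrix.one_apply, eq_comm (a := a)]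
    rw [h0, map_zero, this, Matrix.det_one] at h1
    exact zero_ne_one h1
  obtain ⟨_, -, ⟨x, hx⟩, h⟩ := generically_forall generic_minor
  exact ⟨Matrix.of fun a b => x (a, b), fun S f => h x hx ⟨S, f⟩⟩

end Generic

section SolvedForm

variable {ρ κ τ : Type*} {σ : Type}

theorem algebraicIndependent_sumElim_X {F : Type*} [Field F] [CharZero F] [Finite ρ] [Finite κ]
    [Finite τ] (e : ρ → MvPolynomial (κ ⊕ τ) F) (x : κ ⊕ τ → F)
    (h : LinearIndependent F fun r t => eval x (pderiv (Sum.inr t) (e r))) :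
    AlgebraicIndependent F (Sum.elim e fun k => X (Sum.inl k)) := by
  classical
  have := Fintype.ofFinite κ
  have := Fintype.ofFinite ρ
  refine algebraicIndependent_of_linearIndependent_pderiv _ x ?_
  rw [Fintype.linearIndependent_iff] at h ⊢
  intro g hg
  have hinl : ∀ r, g (Sum.inl r) = 0 := by
    refine h (fun r => g (Sum.inl r)) (funext fun t => ?_)
    simpa [Fintype.sum_sum_type, pderiv_X] using congrFun hg (Sum.inr t)
  rintro (r | k)
  · exact hinl r
  · simpa [Fintype.sum_sum_type, hinl, pderiv_X, Pi.single_apply, apply_ite]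
      using congrFun hg (Sum.inl k)

/-- The solution set of the equations `z (ψ (inl r)) = e r`, each of which is solved for its own
coordinate of `z`, parametrised by the other coordinates of `z` and the unknowns indexed by `τ`. -/
noncomputable def parametrisation {R : Type*} [CommSemiring R] (ψ : ρ ⊕ κ ≃ σ)
    (e : ρ → MvPolynomial (κ ⊕ τ) R) : σ → MvPolynomial (κ ⊕ τ) R :=
  Sum.elim e (fun k => X (Sum.inl k)) ∘ ψ.symm

theorem exists_eval_parametrisation_eq_iff {R : Type*} [CommSemiring R] (ψ : ρ ⊕ κ ≃ σ)
    (e : ρ → MvPolynomial (κ ⊕ τ) R) (z : σ → R) :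
    (∃ x, ∀ s, eval x (parametrisation ψ e s) = z s) ↔
      ∃ y, ∀ r, eval (Sum.elim (fun k => z (ψ (Sum.inr k))) y) (e r) = z (ψ (Sum.inl r)) := by
  have split_iff : ∀ x, (∀ s, eval x (parametrisation ψ e s) = z s) ↔
      (∀ r, eval x (e r) = z (ψ (Sum.inl r))) ∧ ∀ k, x (Sum.inl k) = z (ψ (Sum.inr k)) := by
    simp [← ψ.forall_congr_right, parametrisation]
  simp only [split_iff]
  constructor
  · rintro ⟨x, hx, hz⟩
    refine ⟨x ∘ Sum.inr, fun r => ?_⟩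
    rw [← funext hz, ← hx r]
    exact congrArg (eval · (e r)) (Sum.elim_comp_inl_inr x)
  · rintro ⟨y, hy⟩
    exact ⟨Sum.elim (fun k => z (ψ (Sum.inr k))) y, hy, fun k => rfl⟩

theorem generically_exists_eval_eq [Finite σ] [Finite τ] (ψ : ρ ⊕ κ ≃ σ)
    (e : ρ → MvPolynomial (κ ⊕ τ) ℂ) (x : κ ⊕ τ → ℂ)
    (h : LinearIndependent ℂ fun r t => eval x (pderiv (Sum.inr t) (e r))) :
    Generically fun z : σ → ℂ =>
      ∃ y, ∀ r, eval (Sum.elim (fun k => z (ψ (Sum.inr k))) y) (e r) = z (ψ (Sum.inl r)) := by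
  have : Finite ρ := Finite.of_injective _ (ψ.injective.comp Sum.inl_injective)
  have : Finite κ := Finite.of_injective _ (ψ.injective.comp Sum.inr_injective)
  have hind : AlgebraicIndependent ℂ (parametrisation ψ e) :=
    (algebraicIndependent_sumElim_X e x h).comp _ ψ.symm.injective
  obtain ⟨c, hc, himage⟩ := exists_forall_exists_eval_eq _ hind
  exact generically_iff_exists_eval_ne_zero.2 ⟨c, hc, fun z hz =>
    (exists_eval_parametrisation_eq_iff ψ e z).1 (himage z hz)⟩

theorem generically_not_exists_eval_eq [Fintype ρ] [Finite κ] [Fintype τ] (ψ : ρ ⊕ κ ≃ σ)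
    (e : ρ → MvPolynomial (κ ⊕ τ) ℂ) (h : Fintype.card τ < Fintype.card ρ) :
    Generically fun z : σ → ℂ =>
      ¬ ∃ y, ∀ r, eval (Sum.elim (fun k => z (ψ (Sum.inr k))) y) (e r) = z (ψ (Sum.inl r)) := by
  have := Fintype.ofFinite κ
  have := Fintype.ofEquiv _ ψ
  have hcard : Fintype.card (κ ⊕ τ) < Fintype.card σ := by
    rw [← Fintype.card_congr ψ, Fintype.card_sum, Fintype.card_sum]
    omega
  obtain ⟨p, hp, hp0⟩ := exists_aeval_eq_zero_of_card_lt (parametrisation ψ e) hcard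
  refine generically_iff_exists_eval_ne_zero.2 ⟨p, hp, fun z hz hy => hz ?_⟩
  obtain ⟨x, hx⟩ := (exists_eval_parametrisation_eq_iff ψ e z).2 hy
  have hcomp : (eval x).comp C = RingHom.id ℂ := RingHom.ext fun a => eval_C a
  have := congrArg (eval x) hp0
  rwa [map_zero, map_aeval, algebraMap_eq, hcomp, funext hx] at this

end SolvedForm

variable {G M N : ℕ} {K : Fin G → ℕ}

section StreamPairs

/-- The pairs `(x, y)` of users for which `I` requires the stream of `y` to be nulled at the
receiver of `x`. They index the individual nulling equations. -/
def streamPairs (I : Finset (BSUser K)) : Finset (User K × User K) :=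
  Finset.univ.filter fun e => (e.2.1, e.1) ∈ I

/-- No set of nulling equations outnumbers the free beamformer coordinates it involves. A receive
vector is determined up to scaling and the transmit vectors of a cell up to a change of basis, so
each receiver contributes `M - 1` coordinates and each stream of cell `g` contributes `N - K g`. -/
def IsProper (M N : ℕ) (E : Finset (User K × User K)) : Prop :=
  ∀ E' ⊆ E, E'.card ≤
    (E'.image Prod.fst).card * (M - 1) + ∑ y ∈ E'.image Prod.snd, (N - K y.1)

theorem mem_streamPairs {I : Finset (BSUser K)} {e : User K × User K} :
    e ∈ streamPairs I ↔ (e.2.1, e.1) ∈ I := by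
  simp [streamPairs]

theorem card_streamPairs (I : Finset (BSUser K)) :
    (streamPairs I).card = ∑ p ∈ I, K p.1 := by
  rw [Finset.card_eq_sum_card_fiberwise (f := fun e => (e.2.1, e.1)) (t := I)
    fun e he => mem_streamPairs.1 he]
  refine Finset.sum_congr rfl fun p hp => ?_
  rw [← Fintype.card_fin (K p.1), ← Finset.card_univ,
    ← Finset.card_image_of_injective Finset.univ (f := fun j => (p.2, (⟨p.1, j⟩ : User K)))
      fun j j' h => by simpa using h]
  congr 1
  ext ⟨x, i, j⟩
  simp only [Finset.mem_filter, mem_streamPairs, Finset.mem_image, Finset.mem_univ, true_and]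
  constructor
  · rintro ⟨-, rfl⟩
    exact ⟨j, rfl⟩
  · rintro ⟨_, h⟩
    cases h
    exact ⟨hp, rfl⟩

theorem sum_sigma_univ_comp_fst (f : Fin G → ℕ) (s : Finset (Fin G)) :
    ∑ y ∈ s.sigma fun i => (Finset.univ : Finset (Fin (K i))), f y.1 = ∑ i ∈ s, f i * K i := by
  simp [Finset.sum_sigma, mul_comm]

theorem IsProper.sum_le {I J : Finset (BSUser K)} (hI : IsProper M N (streamPairs I))
    (hJ : J ⊆ I) :
    ∑ p ∈ J, K p.1 ≤ (usersOf J).card * (M - 1) + ∑ l ∈ bsOf J, (N - K l) * K l := by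
  have hfst : (streamPairs J).image Prod.fst ⊆ usersOf J := by
    rw [Finset.image_subset_iff]
    exact fun e he => Finset.mem_image_of_mem Prod.snd (mem_streamPairs.1 he)
  have hsnd : (streamPairs J).image Prod.snd ⊆ (bsOf J).sigma fun _ => Finset.univ := by
    rw [Finset.image_subset_iff]
    exact fun e he => Finset.mem_sigma.2
      ⟨Finset.mem_image_of_mem Prod.fst (mem_streamPairs.1 he), Finset.mem_univ _⟩
  rw [← card_streamPairs, ← sum_sigma_univ_comp_fst fun i => N - K i]
  refine (hI _ fun e he => mem_streamPairs.2 (hJ (mem_streamPairs.1 he))).trans ?_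
  gcongr

theorem sum_excess_le {I : Finset (BSUser K)}
    (hI : ∀ J ⊆ I, ∑ p ∈ J, K p.1 ≤
      (usersOf J).card * (M - 1) + ∑ l ∈ bsOf J, (N - K l) * K l) (A : Finset (User K)) :
    ∑ i, ((I.filter fun p => p.1 = i ∧ p.2 ∈ A).card - (N - K i)) * K i ≤ A.card * (M - 1) := by
  set d : Fin G → ℕ := fun i => (I.filter fun p => p.1 = i ∧ p.2 ∈ A).card
  set T : Finset (Fin G) := Finset.univ.filter fun i => N - K i < d i
  set J : Finset (BSUser K) := I.filter fun p => p.2 ∈ A ∧ p.1 ∈ T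
  have husers : usersOf J ⊆ A := by
    rw [usersOf, Finset.image_subset_iff]
    exact fun p hp => (Finset.mem_filter.1 hp).2.1
  have hbs : bsOf J ⊆ T := by
    rw [bsOf, Finset.image_subset_iff]
    exact fun p hp => (Finset.mem_filter.1 hp).2.2
  have hsum : ∑ p ∈ J, K p.1 = ∑ i ∈ T, d i * K i := by
    rw [← Finset.sum_fiberwise_of_maps_to fun p hp => (Finset.mem_filter.1 hp).2.2]
    refine Finset.sum_congr rfl fun i hi => ?_
    rw [Finset.sum_congr rfl fun p hp => congrArg K (Finset.mem_filter.1 hp).2, Finset.sum_const,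
      smul_eq_mul, Finset.filter_filter]
    congr 2
    exact Finset.filter_congr fun p _ => by aesop
  -- Only cells in `T` contribute to the sum, and for them truncated subtraction is exact.
  have hexcess : ∑ i, (d i - (N - K i)) * K i + ∑ i ∈ T, (N - K i) * K i =
      ∑ i ∈ T, d i * K i := by
    rw [← Finset.sum_subset (Finset.subset_univ T), ← Finset.sum_add_distrib]
    · refine Finset.sum_congr rfl fun i hi => ?_
      rw [← add_mul, Nat.sub_add_cancel (Finset.mem_filter.1 hi).2.le]
    · intro i _ hi
      rw [Nat.sub_eq_zero_of_le (by simpa [T] using hi), zero_mul]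
  have : ∑ i ∈ T, d i * K i ≤ A.card * (M - 1) + ∑ i ∈ T, (N - K i) * K i := by
    rw [← hsum]
    refine (hI J (Finset.filter_subset _ _)).trans ?_
    gcongr
  change ∑ i, (d i - (N - K i)) * K i ≤ _
  omega

theorem isProper_streamPairs_of_forall {I : Finset (BSUser K)}
    (hI : ∀ J ⊆ I, ∑ p ∈ J, K p.1 ≤
      (usersOf J).card * (M - 1) + ∑ l ∈ bsOf J, (N - K l) * K l) :
    IsProper M N (streamPairs I) := by
  intro E hE
  set d : Fin G → ℕ := fun i => (I.filter fun p => p.1 = i ∧ p.2 ∈ E.image Prod.fst).card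
  have hfibre : ∀ y, (E.filter fun e => e.2 = y).card ≤ d y.1 := by
    intro y
    refine Finset.card_le_card_of_injOn (fun e => (y.1, e.1)) ?_ ?_
    · intro e he
      obtain ⟨heE, rfl⟩ := Finset.mem_filter.1 he
      exact Finset.mem_filter.2
        ⟨mem_streamPairs.1 (hE heE), rfl, Finset.mem_image_of_mem Prod.fst heE⟩
    · intro e he e' he' h
      exact Prod.ext (congrArg Prod.snd h)
        ((Finset.mem_filter.1 he).2.trans (Finset.mem_filter.1 he').2.symm)
  calc E.card = ∑ y ∈ E.image Prod.snd, (E.filter fun e => e.2 = y).card :=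
        Finset.card_eq_sum_card_image Prod.snd E
    _ ≤ ∑ y ∈ E.image Prod.snd, ((d y.1 - (N - K y.1)) + (N - K y.1)) :=
        Finset.sum_le_sum fun y _ => (hfibre y).trans le_tsub_add
    _ ≤ ∑ y : User K, (d y.1 - (N - K y.1)) + ∑ y ∈ E.image Prod.snd, (N - K y.1) := by
        rw [Finset.sum_add_distrib]
        gcongr
        exact Finset.subset_univ _
    _ ≤ (E.image Prod.fst).card * (M - 1) + ∑ y ∈ E.image Prod.snd, (N - K y.1) := by
        gcongr
        rw [← Finset.univ_sigma_univ, sum_sigma_univ_comp_fst fun i => d i - (N - K i)]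
        exact sum_excess_le hI _

theorem isProper_streamPairs_iff (hM : 1 ≤ M) (hN : ∀ g, K g ≤ N) (I : Finset (BSUser K)) :
    IsProper M N (streamPairs I) ↔
      ∀ J ⊆ I, ((usersOf J).card : ℤ) * ((M : ℤ) - 1)
        + ∑ l ∈ bsOf J, ((N : ℤ) - (K l : ℤ)) * (K l : ℤ) ≥ ∑ p ∈ J, (K p.1 : ℤ) := by
  have cast_iff : ∀ J : Finset (BSUser K), ((usersOf J).card : ℤ) * ((M : ℤ) - 1)
        + ∑ l ∈ bsOf J, ((N : ℤ) - (K l : ℤ)) * (K l : ℤ) ≥ ∑ p ∈ J, (K p.1 : ℤ) ↔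
      ∑ p ∈ J, K p.1 ≤ (usersOf J).card * (M - 1) + ∑ l ∈ bsOf J, (N - K l) * K l := fun J => by
    zify [hM, hN]
  simp only [cast_iff]
  exact ⟨fun h J hJ => h.sum_le hJ, isProper_streamPairs_of_forall⟩

end StreamPairs

section Charts

/-- A normal form for beamformers: the entry `rx x` of the receive vector of user `x` is `1`, and
the entries `tx g` of the transmit vectors of cell `g` form an identity matrix. -/
structure Chart (K : Fin G → ℕ) (M N : ℕ) where
  rx : User K → Fin M
  tx : ∀ g, Fin (K g) ↪ Fin N

/-- Index set of the entries of all receive and all transmit vectors. -/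
abbrev Coord (K : Fin G → ℕ) (M N : ℕ) : Type :=
  (Σ _ : User K, Fin M) ⊕ (Σ _ : User K, Fin N)

/-- The entries of given receive and transmit vectors, collected into one vector. -/
def entries {R : Type*} (u : User K → Fin M → R) (v : User K → Fin N → R) : Coord K M N → R :=
  Sum.elim (fun q => u q.1 q.2) fun q => v q.1 q.2

/-- The bilinear form `uᵀ H v` given by the channel matrix of the nulling equation `e`. -/
def pairing {R : Type*} [CommSemiring R] (H : Coeff K M N → R) (e : User K × User K)
    (u : Fin M → R) (v : Fin N → R) : R :=
  dotProduct u ((Matrix.of fun a b => H ((e.2.1, e.1), a, b)).mulVec v)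

theorem map_pairing {R S : Type*} [CommSemiring R] [CommSemiring S] (f : R →+* S)
    (H : Coeff K M N → R) (e : User K × User K) (u : Fin M → R) (v : Fin N → R) :
    f (pairing H e u v) = pairing (f ∘ H) e (f ∘ u) (f ∘ v) := by
  rw [pairing, RingHom.map_dotProduct]
  exact congrArg _ (funext fun a => RingHom.map_mulVec f _ v a)

theorem pairing_single_single {R : Type*} [CommSemiring R] (H : Coeff K M N → R)
    (e : User K × User K) (a : Fin M) (b : Fin N) :
    pairing H e (Pi.single a 1) (Pi.single b 1) = H ((e.2.1, e.1), a, b) := by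
  rw [pairing, Matrix.mulVec_single_one, single_one_dotProduct]
  rfl

theorem pairing_zero_left {R : Type*} [CommSemiring R] (H : Coeff K M N → R)
    (e : User K × User K) (v : Fin N → R) : pairing H e 0 v = 0 :=
  zero_dotProduct _

theorem pairing_zero_right {R : Type*} [CommSemiring R] (H : Coeff K M N → R)
    (e : User K × User K) (u : Fin M → R) : pairing H e u 0 = 0 := by
  rw [pairing, Matrix.mulVec_zero, dotProduct_zero]

theorem derivation_pairing {R S : Type*} [CommSemiring R] [CommSemiring S] [Algebra R S]
    (D : Derivation R S S) {H : Coeff K M N → S} (hH : ∀ q, D (H q) = 0) (e : User K × User K)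
    (u : Fin M → S) (v : Fin N → S) :
    D (pairing H e u v) = pairing H e (D ∘ u) v + pairing H e u (D ∘ v) := by
  simp only [pairing, dotProduct, Matrix.mulVec, Matrix.of_apply, map_sum, Derivation.leibniz, hH,
    smul_eq_mul, mul_zero, add_zero, Function.comp_apply, Finset.sum_add_distrib]
  rw [add_comm]
  congr 1
  exact Finset.sum_congr rfl fun a _ => mul_comm _ _

namespace Chart

instance : Finite (Chart K M N) :=
  Finite.of_injective (fun c : Chart K M N => (c.rx, c.tx)) fun c c' h => by
    cases c
    cases c'
    simpa using h

theorem nonempty (hM : 1 ≤ M) (hN : ∀ g, K g ≤ N) : Nonempty (Chart K M N) :=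
  ⟨⟨fun _ => ⟨0, hM⟩, fun g => Fin.castLEEmb (hN g)⟩⟩

variable (c : Chart K M N)

/-- The entries of the beamformers occurring in the equations `E` that the chart leaves free. -/
def free (E : Finset (User K × User K)) : Finset (Coord K M N) :=
  ((E.image Prod.fst).sigma fun x => Finset.univ.erase (c.rx x)).disjSum
    ((E.image Prod.snd).sigma fun y => (Finset.univ.map (c.tx y.1))ᶜ)

variable {E : Finset (User K × User K)}

theorem inl_mem_free {x : User K} {a : Fin M} :
    Sum.inl ⟨x, a⟩ ∈ c.free E ↔ (∃ e ∈ E, e.1 = x) ∧ a ≠ c.rx x := by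
  simp only [free, Finset.inl_mem_disjSum, Finset.mem_sigma, Finset.mem_image, Finset.mem_erase,
    Finset.mem_univ, and_true]

theorem inr_mem_free {y : User K} {b : Fin N} :
    Sum.inr ⟨y, b⟩ ∈ c.free E ↔ (∃ e ∈ E, e.2 = y) ∧ ∀ j, c.tx y.1 j ≠ b := by
  simp only [free, Finset.inr_mem_disjSum, Finset.mem_sigma, Finset.mem_image, Finset.mem_compl,
    Finset.mem_map, Finset.mem_univ, true_and, not_exists]

theorem card_free (E : Finset (User K × User K)) :
    (c.free E).card =
      (E.image Prod.fst).card * (M - 1) + ∑ y ∈ E.image Prod.snd, (N - K y.1) := by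
  simp [free, Finset.card_disjSum, Finset.card_sigma, Finset.card_compl]

theorem biUnion_free_singleton (E : Finset (User K × User K)) :
    (E.biUnion fun e => c.free {e}) = c.free E := by
  ext (⟨x, a⟩ | ⟨y, b⟩)
  · simp only [Finset.mem_biUnion, inl_mem_free, Finset.mem_singleton, exists_eq_left,
      ← exists_and_right, and_assoc]
  · simp only [Finset.mem_biUnion, inr_mem_free, Finset.mem_singleton, exists_eq_left,
      ← exists_and_right, and_assoc]

theorem free_singleton_subset {e : User K × User K} (he : e ∈ E) : c.free {e} ⊆ c.free E :=
  c.biUnion_free_singleton E ▸ Finset.subset_biUnion_of_mem (fun e => c.free {e}) he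

theorem exists_matching (hE : IsProper M N E) :
    ∃ m : E → Coord K M N, Function.Injective m ∧ ∀ e : E, m e ∈ c.free {e.1} := by
  refine (Finset.all_card_le_biUnion_card_iff_exists_injective _).1 fun s => ?_
  have hs : s.biUnion (fun e => c.free {e.1}) = c.free (s.map (Function.Embedding.subtype _)) := by
    rw [← biUnion_free_singleton, Finset.map_eq_image, Finset.image_biUnion]
    rfl
  rw [hs, card_free, ← Finset.card_map (Function.Embedding.subtype _)]
  refine hE _ fun e he => ?_
  obtain ⟨e, -, rfl⟩ := Finset.mem_map.1 he
  exact e.2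

/-- The channel coefficient for which the nulling equation `e` is solved: the one that multiplies
the two normalised entries. -/
def pivot (e : User K × User K) : Coeff K M N :=
  ((e.2.1, e.1), c.rx e.1, c.tx e.2.1 e.2.2)

theorem pivot_injective : Function.Injective c.pivot := by
  rintro ⟨x, i, j⟩ ⟨x', i', j'⟩ h
  simp only [pivot, Prod.mk.injEq] at h
  obtain ⟨⟨rfl, rfl⟩, -, h⟩ := h
  rw [(c.tx i).injective h]

/-- The channel coefficients, split into the pivots of the equations `E` and all others. -/
noncomputable def pivotEquiv (E : Finset (User K × User K)) :
    E ⊕ ↥(c.pivot '' E)ᶜ ≃ Coeff K M N :=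
  open Classical in
  (Equiv.sumCongr (Equiv.Set.image c.pivot E c.pivot_injective) (Equiv.refl _)).trans
    (Equiv.Set.sumCompl _)

theorem pivotEquiv_inl (e : E) : c.pivotEquiv E (Sum.inl e) = c.pivot e :=
  rfl

theorem pivotEquiv_inr (q : ↥(c.pivot '' E)ᶜ) : c.pivotEquiv E (Sum.inr q) = q := by
  simp [pivotEquiv]

section Beams

variable {R : Type*} [CommSemiring R]

/-- The normalised receive vectors with free entries `Y`. -/
def receive (Y : Coord K M N → R) (x : User K) : Fin M → R :=
  fun a => (Pi.single (c.rx x) 1 : Fin M → R) a + Y (Sum.inl ⟨x, a⟩)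

/-- The normalised transmit vectors with free entries `Y`. -/
def transmit (Y : Coord K M N → R) (y : User K) : Fin N → R :=
  fun b => (Pi.single (c.tx y.1 y.2) 1 : Fin N → R) b + Y (Sum.inr ⟨y, b⟩)

/-- The left-hand side of the nulling equation `e` for normalised beamformers. -/
def residual (H : Coeff K M N → R) (Y : Coord K M N → R) (e : User K × User K) : R :=
  pairing H e (c.receive Y e.1) (c.transmit Y e.2)

theorem map_residual {S : Type*} [CommSemiring S] (f : R →+* S) (H : Coeff K M N → R)
    (Y : Coord K M N → R) (e : User K × User K) :
    f (c.residual H Y e) = c.residual (f ∘ H) (f ∘ Y) e := by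
  rw [residual, map_pairing]
  congr 1 <;> funext a <;> simp [receive, transmit, Pi.single_apply, apply_ite f]

variable {Y : Coord K M N → R}

theorem extend_free_eq_zero (y : ↥(c.free E) → R) :
    ∀ t ∉ c.free E, Function.extend Subtype.val y 0 t = 0 := by
  intro t ht
  refine Function.extend_apply' _ _ _ ?_
  rintro ⟨t', rfl⟩
  exact ht t'.2

theorem receive_rx (hY : ∀ t ∉ c.free E, Y t = 0) (x : User K) :
    c.receive Y x (c.rx x) = 1 := by
  simp [receive, hY _ (mt c.inl_mem_free.1 fun h => h.2 rfl)]

theorem transmit_tx (hY : ∀ t ∉ c.free E, Y t = 0) (g : Fin G) (j k : Fin (K g)) :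
    c.transmit Y ⟨g, k⟩ (c.tx g j) = if j = k then 1 else 0 := by
  have : Y (Sum.inr ⟨⟨g, k⟩, c.tx g j⟩) = 0 := hY _ (mt c.inr_mem_free.1 fun h => h.2 j rfl)
  simp [transmit, this, Pi.single_apply]

theorem receive_extend_entries {u : User K → Fin M → R}
    {v : User K → Fin N → R} (hu : ∀ x, u x (c.rx x) = 1) {e : User K × User K} (he : e ∈ E) :
    c.receive (Function.extend Subtype.val (fun t : c.free E => entries u v t) 0) e.1 = u e.1 := by
  funext a
  rcases eq_or_ne a (c.rx e.1) with rfl | ha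
  · rw [c.receive_rx (c.extend_free_eq_zero _), hu]
  · have hmem : Sum.inl ⟨e.1, a⟩ ∈ c.free E := c.inl_mem_free.2 ⟨⟨e, he, rfl⟩, ha⟩
    rw [receive, Pi.single_eq_of_ne ha, zero_add]
    exact Subtype.val_injective.extend_apply _ _ (⟨_, hmem⟩ : c.free E)

theorem transmit_extend_entries {u : User K → Fin M → R}
    {v : User K → Fin N → R} (hv : ∀ g j k, v ⟨g, k⟩ (c.tx g j) = if j = k then 1 else 0)
    {e : User K × User K} (he : e ∈ E) :
    c.transmit (Function.extend Subtype.val (fun t : c.free E => entries u v t) 0) e.2 = v e.2 := by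
  funext b
  by_cases hb : ∃ j, c.tx e.2.1 j = b
  · obtain ⟨j, rfl⟩ := hb
    exact (c.transmit_tx (c.extend_free_eq_zero _) e.2.1 j e.2.2).trans (hv e.2.1 j e.2.2).symm
  · rw [not_exists] at hb
    have hmem : Sum.inr ⟨e.2, b⟩ ∈ c.free E := c.inr_mem_free.2 ⟨⟨e, he, rfl⟩, hb⟩
    rw [transmit, Pi.single_eq_of_ne (Ne.symm (hb _)), zero_add]
    exact Subtype.val_injective.extend_apply _ _ (⟨_, hmem⟩ : c.free E)

theorem residual_eq_add_pivot (hY : ∀ t ∉ c.free E, Y t = 0) (H : Coeff K M N → R)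
    {e : User K × User K} (he : e ∈ E) :
    c.residual H Y e =
      c.residual (Function.extend Subtype.val (fun q : ↥(c.pivot '' E)ᶜ => H q) 0) Y e +
        H (c.pivot e) := by
  classical
  set H₀ : Coeff K M N → R := Function.extend Subtype.val (fun q : ↥(c.pivot '' E)ᶜ => H q) 0
  obtain ⟨x, g, k⟩ := e
  have term_eq : ∀ a b, c.receive Y x a * (H ((g, x), a, b) * c.transmit Y ⟨g, k⟩ b) =
      c.receive Y x a * (H₀ ((g, x), a, b) * c.transmit Y ⟨g, k⟩ b) +
        if a = c.rx x ∧ b = c.tx g k then H ((g, x), a, b) else 0 := by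
    intro a b
    by_cases hq : ((g, x), a, b) ∈ c.pivot '' (E : Set (User K × User K))
    · obtain ⟨⟨x', g', j⟩, -, h⟩ := id hq
      simp only [pivot, Prod.mk.injEq] at h
      obtain ⟨⟨rfl, rfl⟩, rfl, rfl⟩ := h
      have hH₀ : H₀ _ = 0 := Function.extend_apply' _ _ _ fun ⟨q, h⟩ => q.2 (h ▸ hq)
      simp [hH₀, c.receive_rx hY, c.transmit_tx hY]
    · have hH₀ : H₀ ((g, x), a, b) = H ((g, x), a, b) :=
        Subtype.val_injective.extend_apply _ _ (⟨_, hq⟩ : ↥(c.pivot '' E)ᶜ)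
      rw [hH₀, if_neg, add_zero]
      rintro ⟨rfl, rfl⟩
      exact hq ⟨_, he, rfl⟩
  simp [residual, pairing, dotProduct, Matrix.mulVec, Finset.mul_sum, term_eq,
    Finset.sum_add_distrib, ite_and, pivot]

end Beams

/-- The channel coefficients as polynomials, with the pivots of `E` replaced by `0`. -/
noncomputable def coeffPoly (E : Finset (User K × User K)) :
    Coeff K M N → MvPolynomial (↥(c.pivot '' E)ᶜ ⊕ ↥(c.free E)) ℂ :=
  Function.extend Subtype.val (fun q => X (Sum.inl q)) 0

/-- The beamformer entries as polynomials, with those not free for `E` replaced by `0`. -/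
noncomputable def coordPoly (E : Finset (User K × User K)) :
    Coord K M N → MvPolynomial (↥(c.pivot '' E)ᶜ ⊕ ↥(c.free E)) ℂ :=
  Function.extend Subtype.val (fun t => X (Sum.inr t)) 0

/-- The nulling equation `e ∈ E` solved for its pivot: the pivot expressed as a polynomial in the
channel coefficients that are not pivots of `E` and in the free beamformer entries. -/
noncomputable def solvedPivot (E : Finset (User K × User K)) (e : User K × User K) :
    MvPolynomial (↥(c.pivot '' E)ᶜ ⊕ ↥(c.free E)) ℂ :=
  -c.residual (c.coeffPoly E) (c.coordPoly E) e

theorem eval_comp_coeffPoly (x : ↥(c.pivot '' E)ᶜ ⊕ ↥(c.free E) → ℂ) :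
    eval x ∘ c.coeffPoly E = Function.extend Subtype.val (x ∘ Sum.inl) 0 := by
  ext q
  simp [coeffPoly, Function.apply_extend (eval x), Function.comp_def, Pi.zero_def]

theorem eval_comp_coordPoly (x : ↥(c.pivot '' E)ᶜ ⊕ ↥(c.free E) → ℂ) :
    eval x ∘ c.coordPoly E = Function.extend Subtype.val (x ∘ Sum.inr) 0 := by
  ext s
  simp [coordPoly, Function.apply_extend (eval x), Function.comp_def, Pi.zero_def]

theorem eval_solvedPivot (x : ↥(c.pivot '' E)ᶜ ⊕ ↥(c.free E) → ℂ) (e : User K × User K) :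
    eval x (c.solvedPivot E e) =
      -c.residual (Function.extend Subtype.val (x ∘ Sum.inl) 0)
        (Function.extend Subtype.val (x ∘ Sum.inr) 0) e := by
  rw [solvedPivot, map_neg, map_residual, eval_comp_coeffPoly, eval_comp_coordPoly]

theorem residual_eq_zero_iff (h : Coeff K M N → ℂ) (y : ↥(c.free E) → ℂ) (e : E) :
    c.residual h (Function.extend Subtype.val y 0) e = 0 ↔
      eval (Sum.elim (fun q => h (c.pivotEquiv E (Sum.inr q))) y) (c.solvedPivot E e) =
        h (c.pivotEquiv E (Sum.inl e)) := by
  simp only [pivotEquiv_inl, pivotEquiv_inr]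
  rw [eval_solvedPivot, c.residual_eq_add_pivot (c.extend_free_eq_zero y) h e.2,
    neg_eq_iff_add_eq_zero]
  rfl

theorem feasible_of_residual_eq_zero {I : Finset (BSUser K)} {h : Coeff K M N → ℂ}
    {Y : Coord K M N → ℂ} (hY : ∀ t ∉ c.free (streamPairs I), Y t = 0)
    (hres : ∀ e ∈ streamPairs I, c.residual h Y e = 0) : Feasible I h := by
  refine ⟨star (c.receive Y), c.transmit Y, fun x hx => ?_, fun g => ?_, fun p hp j => ?_⟩
  · simpa [c.receive_rx hY] using congrFun (star_eq_zero.1 hx) (c.rx x)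
  · refine LinearIndependent.of_comp (LinearMap.funLeft ℂ ℂ (c.tx g)) ?_
    convert (Pi.basisFun ℂ (Fin (K g))).linearIndependent with k
    ext j
    simp [LinearMap.funLeft_apply, c.transmit_tx hY, Pi.single_apply]
  · rw [Pi.star_apply, star_star]
    exact hres (p.2, ⟨p.1, j⟩) (mem_streamPairs.2 hp)

end Chart

theorem Feasible.exists_normalised {I : Finset (BSUser K)} {h : Coeff K M N → ℂ}
    (hf : Feasible I h) :
    ∃ (c : Chart K M N) (u : User K → Fin M → ℂ) (v : User K → Fin N → ℂ),
      (∀ x, u x (c.rx x) = 1) ∧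
      (∀ g j k, v ⟨g, k⟩ (c.tx g j) = if j = k then 1 else 0) ∧
      ∀ e ∈ streamPairs I, pairing h e (u e.1) (v e.2) = 0 := by
  obtain ⟨u, v, hu, hv, huv⟩ := hf
  choose rx hrx using fun x => Function.ne_iff.1 (star_ne_zero.2 (hu x))
  choose tx B hB using fun g => exists_mul_submatrix_eq_one (Matrix.of fun k => v ⟨g, k⟩) (hv g)
  refine ⟨⟨rx, tx⟩, fun x => (star (u x) (rx x))⁻¹ • star (u x),
    fun y => ∑ k, B y.1 y.2 k • v ⟨y.1, k⟩, fun x => inv_mul_cancel₀ (hrx x), fun g j k => ?_,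
    fun e he => ?_⟩
  · have := congrFun (congrFun (hB g) k) j
    simpa [Matrix.mul_apply, Matrix.one_apply, eq_comm] using this
  · have hnull : ∀ k, dotProduct (star (u e.1))
        ((Matrix.of fun a b => h ((e.2.1, e.1), a, b)).mulVec (v ⟨e.2.1, k⟩)) = 0 :=
      huv _ (mem_streamPairs.1 he)
    simp only [pairing, Matrix.mulVec_sum, Matrix.mulVec_smul, dotProduct_sum, dotProduct_smul,
      smul_dotProduct, hnull, smul_zero, Finset.sum_const_zero]

theorem Feasible.exists_eval_solvedPivot_eq {I : Finset (BSUser K)} {h : Coeff K M N → ℂ}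
    (hf : Feasible I h) {E : Finset (User K × User K)} (hE : E ⊆ streamPairs I) :
    ∃ (c : Chart K M N) (y : ↥(c.free E) → ℂ), ∀ e : E,
      eval (Sum.elim (fun q => h (c.pivotEquiv E (Sum.inr q))) y) (c.solvedPivot E e) =
        h (c.pivotEquiv E (Sum.inl e)) := by
  obtain ⟨c, u, v, hu, hv, huv⟩ := hf.exists_normalised
  refine ⟨c, fun t => entries u v t, fun e => (c.residual_eq_zero_iff h _ e).1 ?_⟩
  rw [Chart.residual, c.receive_extend_entries hu e.2, c.transmit_extend_entries hv e.2]
  exact huv e (hE e.2)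

end Charts

section Jacobian

namespace Chart

variable (c : Chart K M N) {E : Finset (User K × User K)}

theorem pderiv_inr_coeffPoly (t : c.free E) (q : Coeff K M N) :
    pderiv (Sum.inr t) (c.coeffPoly E q) = 0 := by
  classical
  rw [coeffPoly, Function.apply_extend (pderiv (Sum.inr t))]
  simp [Function.comp_def, Pi.zero_def, pderiv_X]

theorem pderiv_inr_coordPoly (t : c.free E) (s : Coord K M N) :
    pderiv (Sum.inr t) (c.coordPoly E s) = (Pi.single t.1 1 : Coord K M N → _) s := by
  classical
  rw [coordPoly]
  by_cases hs : s ∈ c.free E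
  · rw [Subtype.val_injective.extend_apply _ _ (⟨s, hs⟩ : c.free E), pderiv_X]
    simp [Pi.single_apply, Subtype.ext_iff]
  · rw [c.extend_free_eq_zero _ s hs, map_zero, Pi.single_eq_of_ne]
    rintro rfl
    exact hs t.2

theorem eval_pderiv_solvedPivot (H : ↥(c.pivot '' E)ᶜ → ℂ) (t : c.free E) (e : User K × User K) :
    eval (Sum.elim H 0) (pderiv (Sum.inr t) (c.solvedPivot E e)) =
      -(pairing (Function.extend Subtype.val H 0) e
          (fun a => (Pi.single t.1 1 : Coord K M N → ℂ) (Sum.inl ⟨e.1, a⟩))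
          (Pi.single (c.tx e.2.1 e.2.2) 1) +
        pairing (Function.extend Subtype.val H 0) e (Pi.single (c.rx e.1) 1)
          (fun b => (Pi.single t.1 1 : Coord K M N → ℂ) (Sum.inr ⟨e.2, b⟩))) := by
  have eval_coordPoly : ∀ s, eval (Sum.elim H 0) (c.coordPoly E s) = 0 := fun s => by
    have := congrFun (c.eval_comp_coordPoly (Sum.elim H 0)) s
    simpa [Function.extend_def] using this
  rw [solvedPivot, residual, map_neg, derivation_pairing _ (c.pderiv_inr_coeffPoly t), map_neg,
    map_add, map_pairing, map_pairing, eval_comp_coeffPoly]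
  congr 3 <;> funext i <;>
    simp [receive, transmit, eval_coordPoly, pderiv_inr_coordPoly, Pi.single_apply, apply_ite]

/-- The Jacobian of the solved equations `E` with respect to the free beamformer entries, at the
channel coefficients `H` and at the point where all free entries vanish. -/
noncomputable def jacobian (E : Finset (User K × User K)) (H : Coeff K M N → ℂ) :
    Matrix E (c.free E) ℂ :=
  Matrix.of fun e t => eval (Sum.elim (fun q : ↥(c.pivot '' E)ᶜ => H q) 0)
    (pderiv (Sum.inr t) (c.solvedPivot E e))

theorem jacobian_inl (H : Coeff K M N → ℂ) {x : User K} {a : Fin M}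
    (ha : Sum.inl ⟨x, a⟩ ∈ c.free E) (e : E) :
    c.jacobian E H e ⟨_, ha⟩ =
      if e.1.1 = x then -H ((e.1.2.1, e.1.1), a, c.tx e.1.2.1 e.1.2.2) else 0 := by
  obtain ⟨e, -⟩ := e
  have transmit_part : (fun b => (Pi.single (Sum.inl ⟨x, a⟩) 1 : Coord K M N → ℂ)
      (Sum.inr ⟨e.2, b⟩)) = 0 := by
    simp [_root_.funext_iff]
  rw [jacobian, Matrix.of_apply, eval_pderiv_solvedPivot, transmit_part]
  by_cases he : e.1 = x
  · subst he
    have receive_part : (fun a' => (Pi.single (Sum.inl ⟨e.1, a⟩) 1 : Coord K M N → ℂ)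
        (Sum.inl ⟨e.1, a'⟩)) = Pi.single a 1 := by
      simp [_root_.funext_iff, Pi.single_apply]
    have not_pivot : ((e.2.1, e.1), a, c.tx e.2.1 e.2.2) ∉ c.pivot '' (E : Set _) := by
      rintro ⟨e', -, h⟩
      simp only [pivot, Prod.mk.injEq] at h
      exact (c.inl_mem_free.1 ha).2 (h.1.2 ▸ h.2.1.symm)
    have extend_eq := Subtype.val_injective.extend_apply (fun q : ↥(c.pivot '' E)ᶜ => H q) 0
      ⟨_, not_pivot⟩
    rw [if_pos rfl, receive_part, pairing_single_single, pairing_zero_right, add_zero]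
    exact congrArg Neg.neg extend_eq
  · have receive_part : (fun a' => (Pi.single (Sum.inl ⟨x, a⟩) 1 : Coord K M N → ℂ)
        (Sum.inl ⟨e.1, a'⟩)) = 0 := by
      simp [_root_.funext_iff, he]
    rw [if_neg he, receive_part, pairing_zero_left, pairing_zero_right, add_zero, neg_zero]

theorem jacobian_inr (H : Coeff K M N → ℂ) {y : User K} {b : Fin N}
    (hb : Sum.inr ⟨y, b⟩ ∈ c.free E) (e : E) :
    c.jacobian E H e ⟨_, hb⟩ =
      if e.1.2 = y then -H ((e.1.2.1, e.1.1), c.rx e.1.1, b) else 0 := by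
  obtain ⟨e, -⟩ := e
  have receive_part : (fun a => (Pi.single (Sum.inr ⟨y, b⟩) 1 : Coord K M N → ℂ)
      (Sum.inl ⟨e.1, a⟩)) = 0 := by
    simp [_root_.funext_iff]
  rw [jacobian, Matrix.of_apply, eval_pderiv_solvedPivot, receive_part]
  by_cases he : e.2 = y
  · subst he
    have transmit_part : (fun b' => (Pi.single (Sum.inr ⟨e.2, b⟩) 1 : Coord K M N → ℂ)
        (Sum.inr ⟨e.2, b'⟩)) = Pi.single b 1 := by
      simp [_root_.funext_iff, Pi.single_apply]
    have not_pivot : ((e.2.1, e.1), c.rx e.1, b) ∉ c.pivot '' (E : Set _) := by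
      obtain ⟨x, g, k⟩ := e
      rintro ⟨⟨x', g', j⟩, -, h⟩
      simp only [pivot, Prod.mk.injEq] at h
      obtain ⟨⟨rfl, rfl⟩, -, h⟩ := h
      exact (c.inr_mem_free.1 hb).2 j h
    have extend_eq := Subtype.val_injective.extend_apply (fun q : ↥(c.pivot '' E)ᶜ => H q) 0
      ⟨_, not_pivot⟩
    rw [if_pos rfl, transmit_part, pairing_single_single, pairing_zero_left, zero_add]
    exact congrArg Neg.neg extend_eq
  · have transmit_part : (fun b' => (Pi.single (Sum.inr ⟨y, b⟩) 1 : Coord K M N → ℂ)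
        (Sum.inr ⟨e.2, b'⟩)) = 0 := by
      simp [_root_.funext_iff, he]
    rw [if_neg he, transmit_part, pairing_zero_left, pairing_zero_right, add_zero, neg_zero]

open Classical in
/-- The channel at which the matching `m` makes the equations nondegenerate: its rows at normalised
receive entries are those of `A`, and `m e = inl ⟨x, a⟩` puts a `1` where equation `e` multiplies
the receive entry `a` of user `x` by a normalised transmit entry. -/
noncomputable def matchedChannel (A : Matrix (User K) (Fin N) ℂ) (m : E → Coord K M N) :
    Coeff K M N → ℂ :=
  fun q =>
    if q.2.1 = c.rx q.1.2 then A q.1.2 q.2.2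
    else if ∃ e : E, m e = Sum.inl ⟨q.1.2, q.2.1⟩ ∧
      q = ((e.1.2.1, e.1.1), q.2.1, c.tx e.1.2.1 e.1.2.2) then 1 else 0

theorem jacobian_matchedChannel_inl (A : Matrix (User K) (Fin N) ℂ) {m : E → Coord K M N}
    (hm : Function.Injective m) {e₀ : E} (hfree : m e₀ ∈ c.free {e₀.1}) {x : User K} {a : Fin M}
    (h₀ : m e₀ = Sum.inl ⟨x, a⟩) (ha : Sum.inl ⟨x, a⟩ ∈ c.free E) (e : E) :
    c.jacobian E (c.matchedChannel A m) e ⟨_, ha⟩ = if e = e₀ then -1 else 0 := by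
  rw [h₀, inl_mem_free] at hfree
  obtain ⟨⟨_, he₀, hx⟩, hax⟩ := hfree
  rw [Finset.mem_singleton] at he₀
  subst he₀
  rw [jacobian_inl, matchedChannel]
  by_cases he : e = e₀
  · subst he
    rw [if_pos hx, if_pos rfl, hx, if_neg hax, if_pos ⟨e, h₀, by rw [hx]⟩]
  · rw [if_neg he]
    split_ifs with hex hrx hmatch
    · exact absurd (hrx.trans (congrArg c.rx hex)) hax
    · obtain ⟨e', he', hq⟩ := hmatch
      obtain rfl := hm (he'.trans (hex ▸ h₀.symm))
      exact absurd (Subtype.ext (c.pivot_injective (by simp_all [pivot]))) he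
    · exact neg_zero
    · rfl

theorem jacobian_matchedChannel_inr (A : Matrix (User K) (Fin N) ℂ) (m : E → Coord K M N)
    {y : User K} {b : Fin N} (hb : Sum.inr ⟨y, b⟩ ∈ c.free E) (e : E) :
    c.jacobian E (c.matchedChannel A m) e ⟨_, hb⟩ = if e.1.2 = y then -A e.1.1 b else 0 := by
  rw [jacobian_inr, matchedChannel, if_pos rfl]

theorem eq_zero_of_matched_inr {A : Matrix (User K) (Fin N) ℂ}
    (hA : ∀ (S : Finset (User K)) (f : S ↪ Fin N), (A.submatrix Subtype.val f).det ≠ 0)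
    {m : E → Coord K M N} (hm : Function.Injective m) (hfree : ∀ e : E, m e ∈ c.free {e.1})
    {w : E → ℂ} (hw : Matrix.vecMul w (c.jacobian E (c.matchedChannel A m)) = 0)
    (hinl : ∀ e x a, m e = Sum.inl ⟨x, a⟩ → w e = 0) {e : E} {y : User K} {b : Fin N}
    (he : m e = Sum.inr ⟨y, b⟩) : w e = 0 := by
  classical
  let S : Finset (User K) :=
    {x | ∃ (hx : (x, y) ∈ E) (b : Fin N), m ⟨(x, y), hx⟩ = Sum.inr ⟨y, b⟩}
  choose hmem f hf using fun x : S => (Finset.mem_filter.1 x.2).2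
  let row : S → E := fun x => ⟨(x, y), hmem x⟩
  have row_injective : Function.Injective row := fun x x' h =>
    Subtype.ext (congrArg (fun e : E => e.1.1) h)
  have f_injective : Function.Injective f := fun x x' h =>
    row_injective (hm ((hf x).trans (h ▸ (hf x').symm)))
  have mem_range : ∀ {e : E} {y' b}, m e = Sum.inr ⟨y', b⟩ → e.1.2 = y → e ∈ Set.range row := by
    rintro ⟨⟨x, _⟩, hxy⟩ y' b h rfl
    obtain ⟨⟨_, he, rfl⟩, -⟩ := c.inr_mem_free.1 (h ▸ hfree _)
    obtain rfl := Finset.mem_singleton.1 he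
    exact ⟨⟨x, Finset.mem_filter.2 ⟨Finset.mem_univ _, hxy, b, h⟩⟩, rfl⟩
  -- Once `w` vanishes on the equations matched to receive entries, the columns matched to transmit
  -- entries of `y` see only a square submatrix of `A`.
  have minor_eq : Matrix.vecMul (w ∘ row) (A.submatrix Subtype.val f) = 0 := by
    funext x
    have hx : Sum.inr ⟨y, f x⟩ ∈ c.free E := hf x ▸ c.free_singleton_subset (row x).2 (hfree _)
    refine neg_eq_zero.1 (Eq.trans ?_ (congrFun hw ⟨_, hx⟩))
    simp only [Matrix.vecMul, dotProduct, jacobian_matchedChannel_inr, ← Finset.sum_neg_distrib]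
    refine Fintype.sum_of_injective row row_injective _ _ (fun e' he' => ?_) fun x' => ?_
    · rcases h : m e' with ⟨x', a⟩ | ⟨y', b'⟩
      · rw [hinl e' x' a h, zero_mul]
      · rw [if_neg fun hy => he' (mem_range h hy), mul_zero]
    · simp [row]
  obtain ⟨x, rfl⟩ := mem_range he (by
    obtain ⟨⟨_, h, rfl⟩, -⟩ := c.inr_mem_free.1 (he ▸ hfree _)
    rw [Finset.mem_singleton.1 h])
  exact congrFun (Matrix.eq_zero_of_vecMul_eq_zero (hA S ⟨f, f_injective⟩) minor_eq) x

theorem linearIndependent_jacobian_of_matching {A : Matrix (User K) (Fin N) ℂ}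
    (hA : ∀ (S : Finset (User K)) (f : S ↪ Fin N), (A.submatrix Subtype.val f).det ≠ 0)
    {m : E → Coord K M N} (hm : Function.Injective m) (hfree : ∀ e : E, m e ∈ c.free {e.1}) :
    LinearIndependent ℂ (c.jacobian E (c.matchedChannel A m)).row := by
  refine Matrix.vecMul_injective_iff.1
    ((injective_iff_map_eq_zero (Matrix.vecMulLinear _)).2 fun w hw => ?_)
  have receive_matched : ∀ e x a, m e = Sum.inl ⟨x, a⟩ → w e = 0 := by
    intro e₀ x a h
    have ha : Sum.inl ⟨x, a⟩ ∈ c.free E := h ▸ c.free_singleton_subset e₀.2 (hfree e₀)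
    have coord_eq := congrFun hw ⟨_, ha⟩
    simpa [Matrix.vecMul, dotProduct, c.jacobian_matchedChannel_inl A hm (hfree e₀) h]
      using coord_eq
  funext e
  rcases h : m e with ⟨x, a⟩ | ⟨y, b⟩
  · exact receive_matched e x a h
  · exact c.eq_zero_of_matched_inr hA hm hfree hw receive_matched h

end Chart

end Jacobian

section Feasibility

theorem generically_feasible {I : Finset (BSUser K)} (hM : 1 ≤ M) (hN : ∀ g, K g ≤ N)
    (hI : IsProper M N (streamPairs I)) :
    Generically fun h : Coeff K M N → ℂ => Feasible I h := by
  obtain ⟨c⟩ := Chart.nonempty hM hN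
  obtain ⟨m, hm, hfree⟩ := c.exists_matching hI
  obtain ⟨A, hA⟩ := exists_forall_submatrix_det_ne_zero (User K) (Fin N)
  refine (generically_exists_eval_eq (c.pivotEquiv (streamPairs I))
    (fun e => c.solvedPivot (streamPairs I) e) _
    (c.linearIndependent_jacobian_of_matching hA hm hfree)).mono ?_
  rintro h ⟨y, hy⟩
  exact c.feasible_of_residual_eq_zero (c.extend_free_eq_zero y) fun e he =>
    (c.residual_eq_zero_iff h y ⟨e, he⟩).2 (hy ⟨e, he⟩)

theorem generically_not_feasible {I : Finset (BSUser K)}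
    (hI : ¬ IsProper M N (streamPairs I)) :
    Generically fun h : Coeff K M N → ℂ => ¬ Feasible I h := by
  unfold IsProper at hI
  push Not at hI
  obtain ⟨E, hE, hlt⟩ := hI
  refine (generically_forall fun c : Chart K M N =>
    generically_not_exists_eval_eq (c.pivotEquiv E) (fun e => c.solvedPivot E e) ?_).mono ?_
  · rwa [Fintype.card_coe, Fintype.card_coe, c.card_free]
  · intro h hc hf
    obtain ⟨c, y, hy⟩ := hf.exists_eval_solvedPivot_eq hE
    exact hc c ⟨y, hy⟩

theorem Feasible.one_le_and_le (hK : ∃ g, 0 < K g) {I : Finset (BSUser K)} {h : Coeff K M N → ℂ}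
    (hf : Feasible I h) : 1 ≤ M ∧ ∀ g, K g ≤ N := by
  obtain ⟨u, v, hu, hv, -⟩ := hf
  obtain ⟨g, hg⟩ := hK
  refine ⟨?_, fun i => by simpa using (hv i).fintype_card_le_finrank⟩
  obtain ⟨a, -⟩ := Function.ne_iff.1 (hu ⟨g, ⟨0, hg⟩⟩)
  exact a.pos

theorem generically_feasible_iff (hK : ∃ g, 0 < K g) (I : Finset (BSUser K)) :
    Generically fun h : Coeff K M N → ℂ => (Feasible I h ↔
      1 ≤ M ∧ (∀ g, K g ≤ N) ∧ IsProper M N (streamPairs I)) := by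
  by_cases hMN : 1 ≤ M ∧ ∀ g, K g ≤ N
  · by_cases hI : IsProper M N (streamPairs I)
    · exact (generically_feasible hMN.1 hMN.2 hI).mono fun h hf =>
        iff_of_true hf ⟨hMN.1, hMN.2, hI⟩
    · exact (generically_not_feasible hI).mono fun h hf => iff_of_false hf fun h => hI h.2.2
  · exact Generically.of_forall fun h => iff_of_false
      (fun hf => hMN (hf.one_le_and_le hK)) fun h => hMN ⟨h.1, h.2.1⟩

end Feasibility

end CellularIA

theorem theorem1_general (G M N : ℕ) (K : Fin G → ℕ) (hK : ∃ g, 0 < K g)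
    (I : Finset (CellularIA.BSUser K)) :
    (CellularIA.Generically fun h : CellularIA.Coeff K M N → ℂ =>
      (CellularIA.Feasible I h ↔
        1 ≤ M ∧ (∀ g, K g ≤ N) ∧
          ∀ J ⊆ I,
            ((CellularIA.usersOf J).card : ℤ) * ((M : ℤ) - 1)
              + ∑ l ∈ CellularIA.bsOf J, ((N : ℤ) - (K l : ℤ)) * (K l : ℤ)
              ≥ ∑ p ∈ J, (K p.1 : ℤ))) ∧
    (∀ k : ℕ, (∀ g, K g = k) →
      CellularIA.Generically fun h : CellularIA.Coeff K M N → ℂ =>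
        (CellularIA.Feasible I h ↔
          1 ≤ M ∧ k ≤ N ∧
            ∀ J ⊆ I,
              ((CellularIA.usersOf J).card : ℤ) * ((M : ℤ) - 1)
                + ((CellularIA.bsOf J).card : ℤ) * (((N : ℤ) - (k : ℤ)) * (k : ℤ))
                ≥ (J.card : ℤ) * (k : ℤ))) := by
  have paper_form : CellularIA.Generically fun h : CellularIA.Coeff K M N → ℂ =>
      (CellularIA.Feasible I h ↔ 1 ≤ M ∧ (∀ g, K g ≤ N) ∧ ∀ J ⊆ I,
        ((CellularIA.usersOf J).card : ℤ) * ((M : ℤ) - 1)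
          + ∑ l ∈ CellularIA.bsOf J, ((N : ℤ) - (K l : ℤ)) * (K l : ℤ)
          ≥ ∑ p ∈ J, (K p.1 : ℤ)) :=
    (CellularIA.generically_feasible_iff hK I).mono fun h hf =>
      hf.trans (and_congr_right fun hM => and_congr_right fun hN =>
        CellularIA.isProper_streamPairs_iff hM hN I)
  refine ⟨paper_form, fun k hk => paper_form.mono fun h hf => hf.trans ?_⟩
  have : Nonempty (Fin G) := hK.nonempty
  simp only [hk, forall_const, Finset.sum_const, nsmul_eq_mul]

theorem theorem1 (G M N : ℕ) (K : Fin G → ℕ) (hK : ∃ g, 0 < K g)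
    (I : Finset (CellularIA.BSUser K)) (hI : ∀ p ∈ I, p.2.1 ≠ p.1) :
    (CellularIA.Generically fun h : CellularIA.Coeff K M N → ℂ =>
      (CellularIA.Feasible I h ↔
        1 ≤ M ∧ (∀ g, K g ≤ N) ∧
          ∀ J ⊆ I,
            ((CellularIA.usersOf J).card : ℤ) * ((M : ℤ) - 1)
              + ∑ l ∈ CellularIA.bsOf J, ((N : ℤ) - (K l : ℤ)) * (K l : ℤ)
              ≥ ∑ p ∈ J, (K p.1 : ℤ))) ∧
    (∀ k : ℕ, (∀ g, K g = k) →
      CellularIA.Generically fun h : CellularIA.Coeff K M N → ℂ =>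
        (CellularIA.Feasible I h ↔
          1 ≤ M ∧ k ≤ N ∧
            ∀ J ⊆ I,
              ((CellularIA.usersOf J).card : ℤ) * ((M : ℤ) - 1)
                + ((CellularIA.bsOf J).card : ℤ) * (((N : ℤ) - (k : ℤ)) * (k : ℤ))
                ≥ (J.card : ℤ) * (k : ℤ))) :=
  theorem1_general G M N K hK I
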